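/- Let $k$ be a field and let $s \geq 1$ be an integer. Let $(E_r,d_r,i_r)_{r\geq s}$ be a cohomological spectral sequence of $k$-vector spaces starting at $s$: for all $p,q\in\mathbb{Z}$ and all integers $r\geq s$, a $k$-vector space $E_r^{p,q}$, linear maps $d_r^{p,q}:E_r^{p,q}\to E_r^{p+r,q-r+1}$ with $d_r\circ d_r=0$, and isomorphisms $i_r^{p,q}:\operatorname{Ker}(d_r^{p,q})/\operatorname{Im}(d_r^{p-r,q+r-1})\to E_{r+1}^{p,q}$ (no boundedness is assumed). Then there are a cochain complex $(M,d)$ of $k$-vector spaces indexed by $\mathbb{Z}$ and a decreasing filtration $\{F^pM\}_{p\in\mathbb{Z}}$ of $M$ by subcomplexes, which is exhaustive ($\bigcup_p F^pM=M$) and graded complete (for every $n$ the canonical map $M^n\to\varprojlim_p M^n/F^pM^n$ is bijective; in particular the filtration is Hausdorff), such that the spectral sequence starting at $s$ associated to the filtration of $M$ is isomorphic to $(E_r,d_r,i_r)_{r\geq s}$. In particular (case $s=1$), every spectral sequence over $k$ arises, up to isomorphism, as the spectral sequence of a filtration on a complex. Here the spectral sequence associated to the filtration has $$E_r^{p,q}(M)=\frac{Z_r^{p,q}}{Z_{r-1}^{p+1,q-1}+d\big(Z_{r-1}^{p-r+1,q+r-2}\big)},\qquad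 Z_r^{p,q}=\{x\in F^pM^{p+q} : dx\in F^{p+r}M^{p+q+1}\},$$ differential $d_r[x]=[dx]$, and the identification of the cohomology of $(E_r(M),d_r)$ with $E_{r+1}(M)$ sends the cohomology class of $[x]$, for $x\in Z_{r+1}^{p,q}$, to $[x]$. An isomorphism of spectral sequences is a family of bigraded linear isomorphisms $f_r$, $r\geq s$, of bidegree $(0,0)$, with $f_r d_r=d'_r f_r$ and $f_{r+1}\circ i_r=i'_r\circ H(f_r)$. -/

import Mathlib

open CategoryTheory

universe u v

/-- A filtered complex of `k`-modules: a cochain complex `M` indexed by `ℤ`, with a decreasing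
filtration `⋯ ⊇ F^p M ⊇ F^{p+1} M ⊇ ⋯` (`p : ℤ`) of the underlying graded module such that
`d (F^p M) ⊆ F^p M`; `F p n` is the submodule `F^p M^n` of `M^n`. -/
structure FilteredComplex (k : Type u) [CommRing k] where
  /-- the underlying complex -/
  M : CochainComplex (ModuleCat.{v} k) ℤ
  /-- the filtration -/
  F (p n : ℤ) : Submodule k (M.X n)
  anti {p p' : ℤ} (h : p ≤ p') (n : ℤ) : F p' n ≤ F p n
  d_mem (p n : ℤ) (x : M.X n) (hx : x ∈ F p n) : (M.d n (n + 1)).hom x ∈ F p (n + 1)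

namespace FilteredComplex

variable {k : Type u} [CommRing k] (A : FilteredComplex.{u, v} k)

/-- The filtration is exhaustive: `⋃ p, F^p M = M`. -/
def IsExhaustive : Prop :=
  ∀ (n : ℤ) (x : A.M.X n), ∃ p : ℤ, x ∈ A.F p n

/-- The filtration is graded complete: in each degree `n`, the canonical map
`M^n → lim_p M^n / F^p M^n` is bijective. In particular the filtration is Hausdorff. -/
def IsGradedComplete : Prop :=
  ∀ (n : ℤ) (y : (p : ℤ) → A.M.X n ⧸ A.F p n),
    (∀ (p p' : ℤ) (h : p ≤ p'), Submodule.factor (A.anti h n) (y p') = y p) →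
      ∃! x : A.M.X n, ∀ p : ℤ, (A.F p n).mkQ x = y p

/-- `Z_r^p` in degree `n`: the `x ∈ F^p M^n` with `d x ∈ F^{p+r} M^{n+1}`. -/
def Z (r p n : ℤ) : Submodule k (A.M.X n) :=
  A.F p n ⊓ (A.F (p + r) (n + 1)).comap (A.M.d n (n + 1)).hom

/-- The denominator `Z_{r-1}^{p+1} + d (Z_{r-1}^{p-r+1})` in degree `n`. -/
def B (r p n : ℤ) : Submodule k (A.M.X n) :=
  A.Z (r - 1) (p + 1) n ⊔ (A.Z (r - 1) (p - r + 1) (n - 1)).map (A.M.d (n - 1) n).hom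

variable {A}

lemma mem_Z {r p n p' n' : ℤ} (hp : p + r = p') (hn : n + 1 = n') {x : A.M.X n} :
    x ∈ A.Z r p n ↔ x ∈ A.F p n ∧ (A.M.d n n').hom x ∈ A.F p' n' := by
  subst hp hn; rfl

lemma mem_B {r p n p' m : ℤ} (hp : p' + r = p + 1) (hm : m + 1 = n) {x : A.M.X n} :
    x ∈ A.B r p n ↔ ∃ y ∈ A.Z (r - 1) (p + 1) n, ∃ z ∈ A.Z (r - 1) p' m,
      y + (A.M.d m n).hom z = x := by
  obtain rfl : p' = p - r + 1 := by lia
  obtain rfl : m = n - 1 := by lia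
  simp [B, Submodule.mem_sup]

lemma d_d_apply (i j l : ℤ) (x : A.M.X i) : (A.M.d j l).hom ((A.M.d i j).hom x) = 0 := by
  rw [← LinearMap.comp_apply, ← ModuleCat.hom_comp, A.M.d_comp_d]; rfl

lemma d_mem_Z {r p n p' n' : ℤ} (s : ℤ) (hp : p + r = p') (hn : n + 1 = n') {x : A.M.X n}
    (hx : x ∈ A.Z r p n) : (A.M.d n n').hom x ∈ A.Z s p' n' := by
  rw [mem_Z rfl rfl]
  refine ⟨((mem_Z hp hn).1 hx).2, ?_⟩
  rw [d_d_apply]; exact zero_mem _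

lemma Z_le {r p s q n : ℤ} (h₁ : q ≤ p) (h₂ : q + s ≤ p + r) : A.Z r p n ≤ A.Z s q n :=
  fun _ hx => ⟨A.anti h₁ n hx.1, A.anti h₂ (n + 1) hx.2⟩

lemma B_le_Z (r p n : ℤ) : A.B r p n ≤ A.Z r p n := by
  intro x hx
  obtain ⟨y, hy, z, hz, rfl⟩ :=
    (mem_B (p' := p - r + 1) (m := n - 1) (by lia) (by lia)).1 hx
  exact add_mem (Z_le (by lia) (by lia) hy) (d_mem_Z r (by lia) (by lia) hz)

variable (A)

/-- The module `E_r^p` in degree `n`: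
`Z_r^p / (Z_{r-1}^{p+1} + d (Z_{r-1}^{p-r+1}))`. -/
abbrev E (r p n : ℤ) : Type v :=
  A.Z r p n ⧸ (A.B r p n).submoduleOf (A.Z r p n)

variable {A}

/-- The class in `E_r^p` of an element of `Z_r^p`. -/
def E.mk (r p n : ℤ) : A.Z r p n →ₗ[k] A.E r p n :=
  ((A.B r p n).submoduleOf (A.Z r p n)).mkQ

lemma E.mk_surjective (r p n : ℤ) : Function.Surjective (E.mk (A := A) r p n) :=
  Submodule.mkQ_surjective _

lemma E.mk_eq_zero {r p n : ℤ} {x : A.Z r p n} :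
    E.mk r p n x = 0 ↔ (x : A.M.X n) ∈ A.B r p n := by
  rw [E.mk, Submodule.mkQ_apply, Submodule.Quotient.mk_eq_zero]
  rfl

/-- The restriction `Z_r^p → Z_r^{p+r}` of the differential of the complex. -/
def dZ {r p n p' n' : ℤ} (hp : p + r = p') (hn : n + 1 = n') :
    A.Z r p n →ₗ[k] A.Z r p' n' :=
  (A.M.d n n').hom.restrict fun _ hx => d_mem_Z r hp hn hx

/-- The differential `d_r` of the `r`-th page: `d_r [x] = [d x]`. -/
def dE {r p n p' n' : ℤ} (hp : p + r = p') (hn : n + 1 = n') :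
    A.E r p n →ₗ[k] A.E r p' n' :=
  Submodule.mapQ _ _ (dZ hp hn) (by
    intro x hx
    change (A.M.d n n').hom x.1 ∈ A.B r p' n'
    replace hx : x.1 ∈ A.B r p n := hx
    obtain ⟨y, hy, z, hz, hx⟩ :=
      (mem_B (p' := p - r + 1) (m := n - 1) (by lia) (by lia)).1 hx
    refine (mem_B (p' := p + 1) (by lia) hn).2 ⟨0, zero_mem _, y, hy, ?_⟩
    rw [← hx, map_add, d_d_apply, zero_add, add_zero])

lemma dE_mk {r p n p' n' : ℤ} (hp : p + r = p') (hn : n + 1 = n') (x : A.Z r p n) :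
    dE hp hn (E.mk r p n x) = E.mk r p' n' (dZ hp hn x) := rfl

lemma dE_dE {r p n p' n' p'' n'' : ℤ} (hp : p + r = p') (hn : n + 1 = n')
    (hp' : p' + r = p'') (hn' : n' + 1 = n'') (x : A.E r p n) :
    dE hp' hn' (dE hp hn x) = 0 := by
  obtain ⟨x, rfl⟩ := E.mk_surjective r p n x
  rw [dE_mk, dE_mk, E.mk_eq_zero]
  change (A.M.d n' n'').hom ((A.M.d n n').hom x.1) ∈ _
  rw [d_d_apply]; exact zero_mem _

variable (A)

lemma rel_deg {r : ℤ} {a b : ℤ × ℤ} (h : (ComplexShape.up' (⟨r, 1 - r⟩ : ℤ × ℤ)).Rel a b) :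
    a.1 + r = b.1 ∧ a.1 + a.2 + 1 = b.1 + b.2 := by
  obtain rfl : a + ⟨r, 1 - r⟩ = b := h
  constructor
  · rfl
  · simp only [Prod.fst_add, Prod.snd_add]; ring

open scoped Classical in
/-- The `r`-th page of the spectral sequence of the filtration: in position `(p, q)` it is `E_r^p`
in total degree `p + q`, and `d_r` has bidegree `(r, 1 - r)`. -/
noncomputable def page (r : ℤ) :
    HomologicalComplex (ModuleCat.{v} k) (ComplexShape.up' (⟨r, 1 - r⟩ : ℤ × ℤ)) where
  X a := ModuleCat.of k (A.E r a.1 (a.1 + a.2))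
  d a b := if h : (ComplexShape.up' (⟨r, 1 - r⟩ : ℤ × ℤ)).Rel a b then
      ModuleCat.ofHom (dE (rel_deg h).1 (rel_deg h).2) else 0
  shape _ _ h := dif_neg h
  d_comp_d' a b c h h' := by
    rw [dif_pos h, dif_pos h', ← ModuleCat.ofHom_comp, ← ModuleCat.ofHom_zero]
    exact congrArg ModuleCat.ofHom (LinearMap.ext fun x => dE_dE _ _ _ _ x)

lemma page_d {r : ℤ} {a b : ℤ × ℤ} (h : (ComplexShape.up' (⟨r, 1 - r⟩ : ℤ × ℤ)).Rel a b) :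
    (A.page r).d a b = ModuleCat.ofHom (dE (rel_deg h).1 (rel_deg h).2) := dif_pos h

section Homology

variable (r : ℤ) (a : ℤ × ℤ)

/-- The three consecutive terms of the `r`-th page around the position `a`. -/
noncomputable abbrev sc : ShortComplex (ModuleCat.{v} k) :=
  (A.page r).sc' (a - ⟨r, 1 - r⟩) a (a + ⟨r, 1 - r⟩)

lemma rel_prev : (ComplexShape.up' (⟨r, 1 - r⟩ : ℤ × ℤ)).Rel (a - ⟨r, 1 - r⟩) a :=
  sub_add_cancel _ _

lemma rel_next : (ComplexShape.up' (⟨r, 1 - r⟩ : ℤ × ℤ)).Rel a (a + ⟨r, 1 - r⟩) := rfl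

/-- The map `Z_{r+1}^p → E_r^p`, `x ↦ [x]`. -/
noncomputable def toE : A.Z (r + 1) a.1 (a.1 + a.2) →ₗ[k] A.E r a.1 (a.1 + a.2) :=
  E.mk r a.1 (a.1 + a.2) ∘ₗ Submodule.inclusion (Z_le le_rfl (by lia))

/-- The map `Z_{r+1}^p → Ker d_r`, `x ↦ [x]`. -/
noncomputable def toKer : A.Z (r + 1) a.1 (a.1 + a.2) →ₗ[k] LinearMap.ker (A.sc r a).g.hom :=
  LinearMap.codRestrict _ (A.toE r a) (by
      intro x
      change ((A.page r).d a _).hom _ = 0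
      rw [page_d A (rel_next r a)]
      change dE _ _ (E.mk r _ _ _) = 0
      rw [dE_mk, E.mk_eq_zero]
      refine (mem_B (p' := a.1 + 1) (by simp; ring) (rel_deg (rel_next r a)).2).2
        ⟨(A.M.d _ _).hom x.1, ?_, 0, zero_mem _, ?_⟩
      · exact d_mem_Z _ (by simp; ring) (rel_deg (rel_next r a)).2 x.2
      · rw [map_zero, add_zero]; rfl)

/-- The map from `Z_{r+1}^p` to the cohomology of the `r`-th page, sending `x` to the
cohomology class of `[x]`. -/
noncomputable def toHomology :
    A.Z (r + 1) a.1 (a.1 + a.2) →ₗ[k] LinearMap.ker (A.sc r a).g.hom ⧸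
      LinearMap.range (A.sc r a).moduleCatToCycles :=
  (LinearMap.range (A.sc r a).moduleCatToCycles).mkQ ∘ₗ A.toKer r a

lemma toHomology_surjective : Function.Surjective (A.toHomology r a) := by
  intro y
  obtain ⟨⟨y, hy⟩, rfl⟩ := Submodule.mkQ_surjective _ y
  obtain ⟨x, rfl⟩ := E.mk_surjective r a.1 (a.1 + a.2) y
  replace hy : ((A.page r).d a (a + ⟨r, 1 - r⟩)).hom (E.mk r a.1 (a.1 + a.2) x) = 0 := hy
  have hdeg := rel_deg (rel_next r a)
  rw [page_d A (rel_next r a)] at hy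
  change dE hdeg.1 hdeg.2 (E.mk r _ _ x) = 0 at hy
  rw [dE_mk, E.mk_eq_zero] at hy
  obtain ⟨y, hy, z, hz, h⟩ := (mem_B (p' := a.1 + 1) (by simp; ring) hdeg.2).1 hy
  replace h : y + (A.M.d _ _).hom z = (A.M.d _ _).hom x.1 := h
  have hx := (mem_Z hdeg.1 hdeg.2).1 x.2
  have hzr := Z_le (s := r) (q := a.1) (by lia) (by lia) hz
  have hw : x.1 - z ∈ A.Z (r + 1) a.1 (a.1 + a.2) := by
    refine (mem_Z (p' := (a + ⟨r, 1 - r⟩ : ℤ × ℤ).1 + 1) (by simp; ring) hdeg.2).2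
      ⟨sub_mem hx.1 hzr.1, ?_⟩
    rw [map_sub, ← h, add_sub_cancel_right]
    exact hy.1
  refine ⟨⟨_, hw⟩, ?_⟩
  refine congrArg (LinearMap.range (A.sc r a).moduleCatToCycles).mkQ (Subtype.ext ?_)
  change E.mk r a.1 (a.1 + a.2) _ = E.mk r a.1 (a.1 + a.2) _
  rw [← sub_eq_zero, ← map_sub, E.mk_eq_zero]
  refine (mem_B (p' := a.1 - r + 1) (m := a.1 + a.2 - 1) (by lia) (by lia)).2
    ⟨-z, neg_mem hz, 0, zero_mem _, ?_⟩
  rw [map_zero, add_zero]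
  change -z = (x.1 - z) - x.1
  abel

lemma ker_toHomology :
    LinearMap.ker (A.toHomology r a) =
      (A.B (r + 1) a.1 (a.1 + a.2)).submoduleOf (A.Z (r + 1) a.1 (a.1 + a.2)) := by
  have hdeg := rel_deg (rel_prev r a)
  have hp : (a - ⟨r, 1 - r⟩ : ℤ × ℤ).1 = a.1 - r := rfl
  ext x
  have h₁ : x ∈ LinearMap.ker (A.toHomology r a) ↔
      ∃ y : A.E r (a - ⟨r, 1 - r⟩ : ℤ × ℤ).1
          ((a - ⟨r, 1 - r⟩ : ℤ × ℤ).1 + (a - ⟨r, 1 - r⟩ : ℤ × ℤ).2),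
        dE hdeg.1 hdeg.2 y = A.toE r a x := by
    rw [LinearMap.mem_ker, toHomology, LinearMap.comp_apply, Submodule.mkQ_apply,
      Submodule.Quotient.mk_eq_zero, LinearMap.mem_range]
    refine exists_congr fun y => ?_
    rw [Subtype.ext_iff]
    change ((A.page r).d _ a).hom y = A.toE r a x ↔ _
    rw [page_d A (rel_prev r a)]
    rfl
  rw [h₁]
  change _ ↔ x.1 ∈ A.B (r + 1) a.1 (a.1 + a.2)
  rw [mem_B (p' := (a - ⟨r, 1 - r⟩ : ℤ × ℤ).1) (by lia) hdeg.2]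
  constructor
  · rintro ⟨y, hy⟩
    obtain ⟨y, rfl⟩ := E.mk_surjective _ _ _ y
    rw [dE_mk, eq_comm, toE, LinearMap.comp_apply, ← sub_eq_zero, ← map_sub, E.mk_eq_zero] at hy
    obtain ⟨z, hz, w, hw, h⟩ :=
      (mem_B (p' := (a - ⟨r, 1 - r⟩ : ℤ × ℤ).1 + 1) (by lia) hdeg.2).1 hy
    replace h : z + (A.M.d _ _).hom w = x.1 - (A.M.d _ _).hom y.1 := h
    refine ⟨z, ?_, y.1 + w, ?_, ?_⟩
    · refine (mem_Z rfl rfl).2 ⟨hz.1, ?_⟩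
      have : z = x.1 - (A.M.d _ _).hom (y.1 + w) := by
        rw [map_add, ← sub_sub, ← h, add_sub_cancel_right]
      rw [this, map_sub, d_d_apply, sub_zero]
      exact ((mem_Z (p' := a.1 + 1 + (r + 1 - 1)) (by lia) rfl).1 x.2).2
    · exact add_mem (Z_le le_rfl (by lia) y.2) (Z_le (by lia) (by lia) hw)
    · rw [map_add, add_left_comm, h, add_sub_cancel]
  · rintro ⟨z, hz, y, hy, h⟩
    refine ⟨E.mk r _ _ ⟨y, Z_le le_rfl (by lia) hy⟩, ?_⟩
    rw [dE_mk, eq_comm, toE, LinearMap.comp_apply, ← sub_eq_zero, ← map_sub, E.mk_eq_zero]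
    refine (mem_B (p' := (a - ⟨r, 1 - r⟩ : ℤ × ℤ).1 + 1) (by lia) hdeg.2).2
      ⟨z, Z_le le_rfl (by lia) hz, 0, zero_mem _, ?_⟩
    rw [map_zero, add_zero]
    change z = x.1 - (A.M.d _ _).hom y
    rw [← h, add_sub_cancel_right]

/-- The canonical isomorphism `E_{r+1} ≅ H(E_r, d_r)`, sending the class of `x ∈ Z_{r+1}^p` to the
cohomology class of `[x]`. -/
noncomputable def pageEquiv :
    A.E (r + 1) a.1 (a.1 + a.2) ≃ₗ[k] LinearMap.ker (A.sc r a).g.hom ⧸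
      LinearMap.range (A.sc r a).moduleCatToCycles :=
  Submodule.quotEquivOfEq _ _ (A.ker_toHomology r a).symm ≪≫ₗ
    (A.toHomology r a).quotKerEquivOfSurjective (A.toHomology_surjective r a)

lemma pageEquiv_mk (x : A.Z (r + 1) a.1 (a.1 + a.2)) :
    A.pageEquiv r a (E.mk (r + 1) a.1 (a.1 + a.2) x) = A.toHomology r a x := rfl

/-- The canonical isomorphism from the cohomology of the `r`-th page to the `(r+1)`-st page. -/
noncomputable def pageIso : (A.page r).homology a ≅ (A.page (r + 1)).X a :=
  (A.page r).homologyIsoSc' (a - ⟨r, 1 - r⟩) a (a + ⟨r, 1 - r⟩)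
      ((ComplexShape.up' (⟨r, 1 - r⟩ : ℤ × ℤ)).prev_eq' (rel_prev r a))
      ((ComplexShape.up' (⟨r, 1 - r⟩ : ℤ × ℤ)).next_eq' (rel_next r a)) ≪≫
    (A.sc r a).moduleCatHomologyIso ≪≫ (A.pageEquiv r a).symm.toModuleIso

end Homology

/-- The isomorphism `H(E_r, d_r) ≅ E_{r+1}` sends the cohomology class of `[x]` to `[x]`,
for `x ∈ Z_{r+1}^p`. -/
lemma pageIso_hom_apply (r : ℤ) (a : ℤ × ℤ) (x : A.Z (r + 1) a.1 (a.1 + a.2))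
    (c : (A.page r).cycles a) (hc : ((A.page r).iCycles a).hom c = A.toE r a x) :
    (A.pageIso r a).hom.hom (((A.page r).homologyπ a).hom c) =
      E.mk (r + 1) a.1 (a.1 + a.2) x := by
  have h0 : (A.pageIso r a).hom.hom (((A.page r).homologyπ a).hom c) =
     (A.pageEquiv r a).symm
      ((((A.page r).homologyπ a ≫ ((A.page r).homologyIsoSc' (a - ⟨r, 1 - r⟩) a (a + ⟨r, 1 - r⟩)
      ((ComplexShape.up' (⟨r, 1 - r⟩ : ℤ × ℤ)).prev_eq' (rel_prev r a))
      ((ComplexShape.up' (⟨r, 1 - r⟩ : ℤ × ℤ)).next_eq' (rel_next r a))).hom ≫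
      (A.sc r a).moduleCatHomologyIso.hom)).hom c) := rfl
  refine h0.trans ((LinearEquiv.symm_apply_eq _).2 ?_)
  rw [HomologicalComplex.π_homologyIsoSc'_hom_assoc, ShortComplex.π_moduleCatCyclesIso_hom]
  refine congrArg (LinearMap.range (A.sc r a).moduleCatToCycles).mkQ (Subtype.ext ?_)
  change (((HomologicalComplex.cyclesIsoSc' _ _ _ _ _ _).hom ≫ (A.sc r a).moduleCatCyclesIso.hom ≫
    (A.sc r a).moduleCatLeftHomologyData.i).hom c) = A.toE r a x
  rw [ShortComplex.moduleCatCyclesIso_hom_i, HomologicalComplex.cyclesIsoSc'_hom_iCycles]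
  exact hc

/-- The (cohomological) spectral sequence starting at `r₀` associated to a filtered complex. -/
noncomputable def spectralSequence (r₀ : ℤ) :
    CohomologicalSpectralSequence (ModuleCat.{v} k) r₀ where
  page r _ := A.page r
  iso r r' a h _ := A.pageIso r a ≪≫ eqToIso (by subst h; rfl)

end FilteredComplex

/-! Over a field every subquotient splits, so each page is a direct summand of the previous one, and
all pages become images of a decreasing chain of projectors `P r` on the first page. Each `d_r`,
transported there and extended by zero on a complement, gives maps `D a b` with `r = b.1 - a.1`. Any
two of them compose to zero: an image of `d_r` dies on all later pages, and a later page consists of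
cycles for `d_r` (`splitD_splitD`). So the sum of all the `D a b` is a differential on the families
of fixed total degree whose filtration index is bounded below. Boundedness below makes the
filtration by the first index exhaustive, and allowing infinitely many components upwards makes it
complete.

Two facts identify the pages. First, the summands of a component of `dx` never cancel, since the
images of the different `d_r` are independent in the first page (`D_eq_zero_of_dT_eq_zero`);
membership in `Z_r` is thus a condition on each component. Second, a vector `v` killed by all `d_s`
with `s < r` differs from `P r v` by a boundary of controlled filtration (`exists_dT_eq_single`).
Hence the projection of the leading term maps `Z_r` onto the `r`-th page with kernel `B_r`
(`mem_B_iff`), and it respects differentials (`P_d_apply`) and passage to the next page. -/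

/-! ### The total complex of a family of split pages. -/

/-- A bigraded module `V` with a decreasing chain of projectors `P r` and maps `D a b`, where
`D a b` behaves like a differential on the page `r = b.1 - a.1` carried by the image of `P r`. -/
structure SplitPages (k : Type u) [Field k] (r₀ : ℤ) where
  /-- the bigraded module -/
  V : ℤ × ℤ → ModuleCat.{v} k
  /-- the projector onto the `r`-th page -/
  P (r : ℤ) (a : ℤ × ℤ) : V a →ₗ[k] V a
  /-- the differentials -/
  D (a b : ℤ × ℤ) : V a →ₗ[k] V b
  D_eq_zero {a b : ℤ × ℤ} (h : ¬(r₀ ≤ b.1 - a.1 ∧ a.1 + a.2 + 1 = b.1 + b.2)) : D a b = 0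
  P_init (a : ℤ × ℤ) (x : V a) : P r₀ a x = x
  P_P_of_le {r r' : ℤ} (h : r ≤ r') (h₀ : r₀ ≤ r) (a : ℤ × ℤ) (x : V a) :
    P r' a (P r a x) = P r' a x
  P_P_of_ge {r r' : ℤ} (h : r ≤ r') (h₀ : r₀ ≤ r) (a : ℤ × ℤ) (x : V a) :
    P r a (P r' a x) = P r' a x
  P_D_self {r : ℤ} {a b : ℤ × ℤ} (h : b.1 - a.1 = r) (x : V a) : P r b (D a b x) = D a b x
  D_P_self {r : ℤ} {a b : ℤ × ℤ} (h : b.1 - a.1 = r) (x : V a) : D a b (P r a x) = D a b x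
  P_D {r : ℤ} {a b : ℤ × ℤ} (h : b.1 - a.1 < r) (x : V a) : P r b (D a b x) = 0
  D_P {r : ℤ} {a b : ℤ × ℤ} (h : b.1 - a.1 < r) (x : V a) : D a b (P r a x) = 0
  D_D (a b c : ℤ × ℤ) (x : V a) : D b c (D a b x) = 0
  -- A cycle of page `r` with zero class on the next page is a boundary. The conditions on `P r` and
  -- `P (r + 1)` place the preimage `y` where `d_r` is the only differential that can be nonzero.
  exact {r : ℤ} (h₀ : r₀ ≤ r) (a : ℤ × ℤ) (x : V a) (hx : P r a x = x)
    (hx' : P (r + 1) a x = 0) (hd : ∀ c : ℤ × ℤ, c.1 - a.1 = r → D a c x = 0) :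
    ∃ (a' : ℤ × ℤ) (y : V a'), a.1 - a'.1 = r ∧ a'.1 + a'.2 + 1 = a.1 + a.2 ∧
      P r a' y = y ∧ P (r + 1) a' y = 0 ∧ D a' a y = x

namespace SplitPages

variable {k : Type u} [Field k] {r₀ : ℤ} (S : SplitPages.{u, v} k r₀)

/-- The families `(x a)` supported in total degree `n` and in filtration bounded below. -/
def T (n : ℤ) : Submodule k (∀ a, S.V a) where
  carrier := {x | ∃ N : ℤ, ∀ a, ¬(N ≤ a.1 ∧ a.1 + a.2 = n) → x a = 0}
  zero_mem' := ⟨0, fun _ _ => rfl⟩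
  add_mem' := by
    rintro x y ⟨N, hN⟩ ⟨N', hN'⟩
    refine ⟨min N N', fun a ha => ?_⟩
    rw [Pi.add_apply, hN a (by lia), hN' a (by lia), add_zero]
  smul_mem' := by
    rintro c x ⟨N, hN⟩
    refine ⟨N, fun a ha => ?_⟩
    rw [Pi.smul_apply, hN a ha, smul_zero]

variable {S}

lemma T.eq_zero {n : ℤ} (x : S.T n) {a : ℤ × ℤ} (ha : a.1 + a.2 ≠ n) : x.1 a = 0 := by
  obtain ⟨N, hN⟩ := x.2
  exact hN a (by lia)

/-- Only positions of total degree `n` with `N ≤ a.1 ≤ b.1 - r₀` can contribute, and `r₀ ≥ 0` bounds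
these by `b.1`. The `finsum` in the total differential is therefore a genuine finite sum. -/
lemma T.finite_support {n : ℤ} (x : S.T n) (b : ℤ × ℤ) (hr₀ : 0 ≤ r₀) :
    (Function.support fun a => S.D a b (x.1 a)).Finite := by
  obtain ⟨N, hN⟩ := x.2
  refine ((Set.finite_Icc N b.1).image fun p => ((p, n - p) : ℤ × ℤ)).subset fun a ha => ?_
  have h₁ : N ≤ a.1 ∧ a.1 + a.2 = n := by
    by_contra h
    exact ha (by simp only [hN a h, map_zero])
  have h₂ : r₀ ≤ b.1 - a.1 := by
    by_contra h
    exact ha (by simp only [S.D_eq_zero (fun h' => h h'.1), LinearMap.zero_apply])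
  exact ⟨a.1, ⟨h₁.1, by lia⟩, Prod.ext rfl (by dsimp only; lia)⟩

/-- The total differential. -/
noncomputable def dT (hr₀ : 0 ≤ r₀) {n n' : ℤ} (hn : n + 1 = n') : S.T n →ₗ[k] S.T n' where
  toFun x := ⟨fun b => ∑ᶠ a, S.D a b (x.1 a), by
    obtain ⟨N, hN⟩ := x.2
    refine ⟨N, fun b hb => finsum_eq_zero_of_forall_eq_zero fun a => ?_⟩
    by_cases h : N ≤ a.1 ∧ a.1 + a.2 = n
    · rw [S.D_eq_zero (by lia), LinearMap.zero_apply]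
    · rw [hN a h, map_zero]⟩
  map_add' x y := by
    refine Subtype.ext (funext fun b => ?_)
    change ∑ᶠ a, S.D a b (x.1 a + y.1 a) = ∑ᶠ a, S.D a b (x.1 a) + ∑ᶠ a, S.D a b (y.1 a)
    simp only [map_add]
    exact finsum_add_distrib (T.finite_support x b hr₀) (T.finite_support y b hr₀)
  map_smul' c x := by
    refine Subtype.ext (funext fun b => ?_)
    change ∑ᶠ a, S.D a b (c • x.1 a) = c • ∑ᶠ a, S.D a b (x.1 a)
    simp only [map_smul]
    exact (smul_finsum' c (T.finite_support x b hr₀)).symm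

lemma dT_apply (hr₀ : 0 ≤ r₀) {n n' : ℤ} (hn : n + 1 = n') (x : S.T n) (b : ℤ × ℤ) :
    (dT hr₀ hn x).1 b = ∑ᶠ a, S.D a b (x.1 a) := rfl

lemma map_dT_apply (hr₀ : 0 ≤ r₀) {n n' : ℤ} (hn : n + 1 = n') (x : S.T n) (b : ℤ × ℤ)
    {W : Type*} [AddCommGroup W] [Module k W] (f : S.V b →ₗ[k] W) :
    f ((dT hr₀ hn x).1 b) = ∑ᶠ a, f (S.D a b (x.1 a)) :=
  f.toAddMonoidHom.map_finsum (T.finite_support x b hr₀)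

lemma dT_dT (hr₀ : 0 ≤ r₀) {n n' n'' : ℤ} (hn : n + 1 = n') (hn' : n' + 1 = n'') (x : S.T n) :
    dT hr₀ hn' (dT hr₀ hn x) = 0 := by
  refine Subtype.ext (funext fun c => finsum_eq_zero_of_forall_eq_zero fun b => ?_)
  rw [map_dT_apply]
  exact finsum_eq_zero_of_forall_eq_zero fun a => S.D_D a b c _

/-- Terms from positions after `a` are values of shorter differentials, which die on page `r`; the
terms before `a` vanish by `h`. Only the term at `a` survives, and `P r` fixes it. -/
lemma P_dT (hr₀ : 0 ≤ r₀) {n n' : ℤ} (hn : n + 1 = n') (x : S.T n) {r : ℤ} {a b : ℤ × ℤ}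
    (hr : b.1 - a.1 = r) (ha : a.1 + a.2 = n)
    (h : ∀ a' : ℤ × ℤ, a'.1 < a.1 → S.D a' b (x.1 a') = 0) :
    S.P r b ((dT hr₀ hn x).1 b) = S.D a b (x.1 a) := by
  rw [map_dT_apply, finsum_eq_single _ a, S.P_D_self hr]
  intro a' ha'
  rcases lt_trichotomy a'.1 a.1 with h₁ | h₁ | h₁
  · rw [h a' h₁, map_zero]
  · rw [T.eq_zero x (fun h₂ => ha' (Prod.ext h₁ (by lia))), map_zero, map_zero]
  · exact S.P_D (by lia) _

/-- No cancellation: starting at the lower bound of `x`, the longest differential not yet known to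
vanish is isolated by the corresponding projector, and induction moves upwards in filtration. -/
lemma D_eq_zero_of_dT_eq_zero (hr₀ : 0 ≤ r₀) {n n' : ℤ} (hn : n + 1 = n') (x : S.T n)
    {b : ℤ × ℤ} (h : (dT hr₀ hn x).1 b = 0) (a : ℤ × ℤ) : S.D a b (x.1 a) = 0 := by
  obtain ⟨N, hN⟩ := x.2
  have key (j : ℕ) : ∀ a : ℤ × ℤ, a.1 < N + j → S.D a b (x.1 a) = 0 := by
    induction j with
    | zero => intro a ha; rw [hN a (by lia), map_zero]
    | succ j ih =>
      intro a ha
      by_cases hn' : a.1 + a.2 = n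
      · rw [← P_dT hr₀ hn x rfl hn' (fun a' ha' => ih a' (by lia)), h, map_zero]
      · rw [T.eq_zero x hn', map_zero]
  exact key (a.1 + 1 - N).toNat a (by lia)

lemma dT_eq_zero_iff (hr₀ : 0 ≤ r₀) {n n' : ℤ} (hn : n + 1 = n') (x : S.T n) (b : ℤ × ℤ) :
    (dT hr₀ hn x).1 b = 0 ↔ ∀ a, S.D a b (x.1 a) = 0 :=
  ⟨D_eq_zero_of_dT_eq_zero hr₀ hn x, finsum_eq_zero_of_forall_eq_zero⟩

/-- The family concentrated in position `a`. -/
noncomputable def single {n : ℤ} (a : ℤ × ℤ) (ha : a.1 + a.2 = n) (v : S.V a) : S.T n :=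
  ⟨Pi.single (M := fun a => S.V a) a v, a.1, fun b hb =>
    Pi.single_eq_of_ne (M := fun a => S.V a) (by rintro rfl; exact hb ⟨le_rfl, ha⟩) v⟩

lemma single_same {n : ℤ} (a : ℤ × ℤ) (ha : a.1 + a.2 = n) (v : S.V a) :
    (single a ha v).1 a = v :=
  Pi.single_eq_same (M := fun a => S.V a) a v

lemma single_of_ne {n : ℤ} {a b : ℤ × ℤ} (ha : a.1 + a.2 = n) (v : S.V a) (h : b ≠ a) :
    (single a ha v).1 b = 0 :=
  Pi.single_eq_of_ne (M := fun a => S.V a) h v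

lemma single_add {n : ℤ} (a : ℤ × ℤ) (ha : a.1 + a.2 = n) (v w : S.V a) :
    single a ha (v + w) = single a ha v + single a ha w :=
  Subtype.ext (Pi.single_add (f := fun a => S.V a) a v w)

lemma dT_single (hr₀ : 0 ≤ r₀) {n n' : ℤ} (hn : n + 1 = n') (a : ℤ × ℤ) (ha : a.1 + a.2 = n)
    (v : S.V a) (b : ℤ × ℤ) : (dT hr₀ hn (single a ha v)).1 b = S.D a b v := by
  rw [dT_apply, finsum_eq_single _ a, single_same]
  intro a' ha'
  rw [single_of_ne _ _ ha', map_zero]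

/-- An element killed by the differentials of the pages before the `r`-th one is, up to its
projection onto the `r`-th page, a boundary. -/
lemma exists_dT_eq_single (hr₀ : 0 ≤ r₀) {n m : ℤ} (hm : m + 1 = n) (a : ℤ × ℤ)
    (ha : a.1 + a.2 = n) (v : S.V a) {r : ℤ} (hr : r₀ ≤ r)
    (hv : ∀ b : ℤ × ℤ, b.1 < a.1 + r → S.D a b v = 0) :
    ∃ z : S.T m, (∀ b : ℤ × ℤ, b.1 < a.1 - r + 1 → z.1 b = 0) ∧
      dT hr₀ hm z = single a ha (v - S.P r a v) := by
  induction r, hr using Int.leInduction with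
  | base =>
    refine ⟨0, fun _ _ => rfl, ?_⟩
    rw [map_zero, S.P_init, sub_self]
    exact (Subtype.ext (Pi.single_zero (M := fun a => S.V a) a)).symm
  | succ r hr ih =>
    obtain ⟨z, hz, hdz⟩ := ih fun b hb => hv b (by lia)
    -- The difference `v - P r v` telescopes; its new piece lies on page `r`, has zero class on page
    -- `r + 1` and is a `d_r`-cycle, so it is `d_r y`.
    obtain ⟨a', y, h₁, h₂, h₃, h₄, h₅⟩ := S.exact hr a (S.P r a v - S.P (r + 1) a v)
      (by rw [map_sub, S.P_P_of_le le_rfl hr, S.P_P_of_ge (by lia) hr])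
      (by rw [map_sub, S.P_P_of_le (by lia) hr, S.P_P_of_le le_rfl (by lia), sub_self])
      (fun c hc => by
        rw [map_sub, S.D_P_self hc, S.D_P (by lia), sub_zero, hv c (by lia)])
    refine ⟨z + single a' (by lia) y, fun b hb => ?_, ?_⟩
    · change z.1 b + _ = 0
      rw [hz b (by lia), single_of_ne _ _ (by rintro rfl; lia), add_zero]
    · have h : dT hr₀ hm (single a' (by lia) y) =
          single a ha (S.P r a v - S.P (r + 1) a v) := by
        refine Subtype.ext (funext fun b => ?_)
        rw [dT_single]
        by_cases hb : b = a
        · subst hb; rw [single_same, h₅]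
        rw [single_of_ne _ _ hb]
        by_cases hdeg : a'.1 + a'.2 + 1 = b.1 + b.2
        -- Shorter differentials kill `y` because `y` lies on page `r`, longer ones because its
        -- projection to page `r + 1` is zero. Hence the total differential of `y` is exactly `d_r
        -- y`.
        · rcases lt_trichotomy (b.1 - a'.1) r with h | h | h
          · rw [← h₃, S.D_P h]
          · exact absurd (Prod.ext (by lia) (by lia)) hb
          · rw [← S.D_P_self rfl, ← S.P_P_of_le (r := r + 1) (by lia) (by lia), h₄, map_zero,
              map_zero]
        · rw [S.D_eq_zero (fun h => hdeg h.2), LinearMap.zero_apply]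
      rw [map_add, hdz, h, ← single_add, sub_add_sub_cancel]

variable (S)

open scoped Classical in
/-- The total complex of the families bounded below. -/
noncomputable def complex (hr₀ : 0 ≤ r₀) : CochainComplex (ModuleCat.{v} k) ℤ where
  X n := ModuleCat.of k (S.T n)
  d n n' := if h : n + 1 = n' then ModuleCat.ofHom (dT hr₀ h) else 0
  shape _ _ h := dif_neg h
  d_comp_d' n n' n'' h h' := by
    have h₁ : n + 1 = n' := h
    have h₂ : n' + 1 = n'' := h'
    rw [dif_pos h₁, dif_pos h₂, ← ModuleCat.ofHom_comp, ← ModuleCat.ofHom_zero]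
    exact congrArg ModuleCat.ofHom (LinearMap.ext fun x => dT_dT hr₀ h₁ h₂ x)

lemma complex_d (hr₀ : 0 ≤ r₀) {n n' : ℤ} (h : n + 1 = n') :
    ((S.complex hr₀).d n n').hom = dT hr₀ h :=
  congrArg ModuleCat.Hom.hom (dif_pos h)

/-- The total complex, filtered by the first index. -/
noncomputable def filteredComplex (hr₀ : 0 ≤ r₀) : FilteredComplex.{u, v} k where
  M := S.complex hr₀
  F p n :=
    { carrier := {x : S.T n | ∀ a : ℤ × ℤ, a.1 < p → x.1 a = 0}
      zero_mem' := fun _ _ => rfl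
      add_mem' := fun {x y} hx hy a ha => by
        change x.1 a + y.1 a = 0
        rw [hx a ha, hy a ha, add_zero]
      smul_mem' := fun c x hx a ha => by
        change c • x.1 a = 0
        rw [hx a ha, smul_zero] }
  anti h n x hx a ha := hx a (by lia)
  d_mem p n x hx := by
    rw [complex_d _ _ rfl]
    intro b hb
    refine finsum_eq_zero_of_forall_eq_zero fun a => ?_
    by_cases ha : a.1 < p
    · exact (congrArg _ (hx a ha)).trans (map_zero _)
    · rw [S.D_eq_zero (by lia), LinearMap.zero_apply]

lemma filteredComplex_d (hr₀ : 0 ≤ r₀) {n n' : ℤ} (h : n + 1 = n') :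
    ((S.filteredComplex hr₀).M.d n n').hom = dT hr₀ h := S.complex_d hr₀ h

lemma isExhaustive (hr₀ : 0 ≤ r₀) : (S.filteredComplex hr₀).IsExhaustive := by
  rintro n ⟨x, N, hN⟩
  exact ⟨N, fun a ha => hN a (by lia)⟩

/-- Modulo `F^p` a family is the same as its components of index below `p`, so a compatible system
determines each component. -/
lemma isGradedComplete (hr₀ : 0 ≤ r₀) : (S.filteredComplex hr₀).IsGradedComplete := by
  intro n y hy
  have hlift (p : ℤ) : ∃ x : S.T n, ((S.filteredComplex hr₀).F p n).mkQ x = y p :=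
    Submodule.mkQ_surjective _ (y p)
  choose x hx using hlift
  have hcompat {p p' : ℤ} (h : p ≤ p') (a : ℤ × ℤ) (ha : a.1 < p) : (x p').1 a = (x p).1 a := by
    have h₁ := hy p p' h
    rw [← hx, ← hx] at h₁
    have h₂ : x p' - x p ∈ (S.filteredComplex hr₀).F p n := (Submodule.Quotient.eq _).1 h₁
    exact sub_eq_zero.1 (h₂ a ha)
  have hmk {p : ℤ} {z w : S.T n} (h : ∀ a : ℤ × ℤ, a.1 < p → z.1 a = w.1 a) :
      ((S.filteredComplex hr₀).F p n).mkQ z = ((S.filteredComplex hr₀).F p n).mkQ w :=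
    (Submodule.Quotient.eq _).2 fun a ha => sub_eq_zero.2 (h a ha)
  obtain ⟨N, hN⟩ := (x 0).2
  -- The component at `a` is visible modulo `F^p` exactly from `p = a.1 + 1` on. For `a.1 < 0` it
  -- agrees with that of the single lift `x 0`, whose bound `N` gives the bound `min N 0`.
  refine ⟨⟨fun a => (x (a.1 + 1)).1 a, min N 0, fun a ha => ?_⟩, fun p => ?_, fun z hz => ?_⟩
  · by_cases hn : a.1 + a.2 = n
    · exact (hcompat (p := a.1 + 1) (p' := 0) (by lia) a (by lia)).symm.trans (hN a (by lia))
    · exact T.eq_zero _ hn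
  · rw [← hx p]
    exact hmk fun a ha => (hcompat (by lia) a (by lia)).symm
  · refine Subtype.ext (funext fun a => ?_)
    have h := (hz (a.1 + 1)).trans (hx (a.1 + 1)).symm
    have h' : (show S.T n from z) - x (a.1 + 1) ∈ (S.filteredComplex hr₀).F (a.1 + 1) n :=
      (Submodule.Quotient.eq _).1 h
    exact sub_eq_zero.1 (h' a (by lia))

/-! ### Cycles, boundaries and leading terms in the filtered total complex. -/

variable {S}

lemma mem_Z_iff_dT (hr₀ : 0 ≤ r₀) {r p n p' n' : ℤ} (hp : p + r = p') (hn : n + 1 = n')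
    {x : S.T n} :
    x ∈ (S.filteredComplex hr₀).Z r p n ↔ (∀ a : ℤ × ℤ, a.1 < p → x.1 a = 0) ∧
      ∀ b : ℤ × ℤ, b.1 < p' → (dT hr₀ hn x).1 b = 0 := by
  refine (FilteredComplex.mem_Z hp hn).trans (and_congr_right fun _ => ?_)
  rw [filteredComplex_d _ _ hn]
  rfl

/-- By the absence of cancellation, the condition on `dx` splits into conditions on the separate
components of `x`, in particular on the leading one. -/
lemma mem_Z (hr₀ : 0 ≤ r₀) {r p n : ℤ} {x : S.T n} :
    x ∈ (S.filteredComplex hr₀).Z r p n ↔ (∀ a : ℤ × ℤ, a.1 < p → x.1 a = 0) ∧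
      ∀ b : ℤ × ℤ, b.1 < p + r → ∀ a, S.D a b (x.1 a) = 0 :=
  (mem_Z_iff_dT hr₀ rfl rfl).trans (and_congr_right fun _ =>
    forall_congr' fun b => imp_congr_right fun _ => dT_eq_zero_iff hr₀ rfl x b)

lemma mem_B_iff_dT (hr₀ : 0 ≤ r₀) {r p n p' m : ℤ} (hp : p' + r = p + 1) (hm : m + 1 = n)
    {x : S.T n} :
    x ∈ (S.filteredComplex hr₀).B r p n ↔
      ∃ y : S.T n, y ∈ (S.filteredComplex hr₀).Z (r - 1) (p + 1) n ∧
        ∃ z : S.T m, z ∈ (S.filteredComplex hr₀).Z (r - 1) p' m ∧ y + dT hr₀ hm z = x := by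
  refine (FilteredComplex.mem_B hp hm).trans ?_
  rw [filteredComplex_d _ _ hm]
  rfl

lemma single_mem_Z (hr₀ : 0 ≤ r₀) {r : ℤ} (a : ℤ × ℤ) {v : S.V a} (hv : S.P r a v = v) :
    single a rfl v ∈ (S.filteredComplex hr₀).Z r a.1 (a.1 + a.2) := by
  refine (mem_Z hr₀).2 ⟨fun b hb => single_of_ne _ _ (by rintro rfl; lia), fun b hb a' => ?_⟩
  by_cases h : a' = a
  · subst h; rw [single_same, ← hv, S.D_P (by lia)]
  · rw [single_of_ne _ _ h, map_zero]

/-- The kernel of the map sending `x` in `Z_r^p` to the projection of its leading term. -/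
lemma mem_B_iff (hr₀ : 0 ≤ r₀) {r : ℤ} (hr : r₀ ≤ r) (a : ℤ × ℤ) {x : S.T (a.1 + a.2)}
    (hx : x ∈ (S.filteredComplex hr₀).Z r a.1 (a.1 + a.2)) :
    x ∈ (S.filteredComplex hr₀).B r a.1 (a.1 + a.2) ↔ S.P r a (x.1 a) = 0 := by
  have hm : a.1 + a.2 - 1 + 1 = a.1 + a.2 := by lia
  rw [mem_B_iff_dT hr₀ (p' := a.1 - r + 1) (by lia) hm]
  constructor
  -- The family `y` starts after `a`, and the component of `dz` at `a` only involves differentials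
  -- of length less than `r`, all killed by `P r`.
  · rintro ⟨y, hy, z, hz, rfl⟩
    change S.P r a (y.1 a + (dT hr₀ hm z).1 a) = 0
    rw [((mem_Z hr₀).1 hy).1 a (by lia), zero_add, map_dT_apply]
    refine finsum_eq_zero_of_forall_eq_zero fun a' => ?_
    by_cases h : a'.1 < a.1 - r + 1
    · rw [((mem_Z hr₀).1 hz).1 a' h, map_zero, map_zero]
    · exact S.P_D (by lia) _
  · intro h
    obtain ⟨z, hz, hdz⟩ := exists_dT_eq_single hr₀ hm a rfl (x.1 a) hr
      fun b hb => ((mem_Z hr₀).1 hx).2 b hb a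
    rw [h, sub_zero] at hdz
    -- The leading term is itself the boundary `dz`. Removing it from `x` raises the filtration by
    -- one and leaves `dx` unchanged, since `d (dz) = 0`.
    refine ⟨x - single a rfl (x.1 a), ?_, z, ?_, ?_⟩
    · refine (mem_Z_iff_dT hr₀ (p' := a.1 + r) (by lia) rfl).2 ⟨fun b hb => ?_, ?_⟩
      · change x.1 b - (single a rfl (x.1 a)).1 b = 0
        by_cases hb' : b = a
        · subst hb'; rw [single_same, sub_self]
        · rw [single_of_ne _ _ hb', sub_zero]
          by_cases hdeg : b.1 + b.2 = a.1 + a.2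
          · exact ((mem_Z hr₀).1 hx).1 b
              (lt_of_le_of_ne (by lia) fun h' => hb' (Prod.ext h' (by lia)))
          · exact T.eq_zero x hdeg
      · rw [← hdz, map_sub, dT_dT, sub_zero]
        exact ((mem_Z_iff_dT hr₀ rfl rfl).1 hx).2
    · refine (mem_Z_iff_dT hr₀ (p' := a.1) (by lia) hm).2 ⟨hz, ?_⟩
      rw [hdz]
      exact fun b hb => single_of_ne _ _ (by rintro rfl; lia)
    · rw [hdz]; exact sub_add_cancel _ _

/-- On leading terms the total differential induces `d_r`: an element of `F^p` has no component
before `a`, so `P_dT` applies. -/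
lemma P_d_apply (hr₀ : 0 ≤ r₀) {r : ℤ} {a b : ℤ × ℤ} (hab : a.1 + r = b.1)
    (hdeg : a.1 + a.2 + 1 = b.1 + b.2) {x : S.T (a.1 + a.2)}
    (hx : x ∈ (S.filteredComplex hr₀).Z r a.1 (a.1 + a.2)) :
    S.P r b ((dT hr₀ hdeg x).1 b) = S.D a b (x.1 a) :=
  P_dT hr₀ hdeg x (by lia) rfl fun a' ha' => by rw [((mem_Z hr₀).1 hx).1 a' ha', map_zero]

end SplitPages

/-! ### Splittings for complexes of vector spaces. -/

section

variable {k : Type u} [Field k] {ι : Type*} {c : ComplexShape ι}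

/-- Over a field, the cycles are a retract of the complex. -/
lemma HomologicalComplex.exists_retraction_iCycles
    (K : HomologicalComplex (ModuleCat.{v} k) c) (i : ι) :
    ∃ q : K.X i ⟶ K.cycles i, K.iCycles i ≫ q = 𝟙 _ := by
  obtain ⟨q, hq⟩ := (K.iCycles i).hom.exists_leftInverse_of_injective
    ((ModuleCat.mono_iff_ker_eq_bot _).1 inferInstance)
  exact ⟨ModuleCat.ofHom q, ModuleCat.hom_ext hq⟩

/-- Over a field, the projection from cycles to homology has a section. -/
lemma HomologicalComplex.exists_section_homologyπ
    (K : HomologicalComplex (ModuleCat.{v} k) c) (i : ι) :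
    ∃ s : K.homology i ⟶ K.cycles i, s ≫ K.homologyπ i = 𝟙 _ := by
  obtain ⟨s, hs⟩ := (K.homologyπ i).hom.exists_rightInverse_of_surjective
    ((ModuleCat.epi_iff_range_eq_top _).1 inferInstance)
  exact ⟨ModuleCat.ofHom s, ModuleCat.hom_ext hs⟩

lemma HomologicalComplex.exists_iCycles_eq (K : HomologicalComplex (ModuleCat.{v} k) c)
    {i j : ι} (hj : c.next i = j) (x : K.X i) (hx : (K.d i j).hom x = 0) :
    ∃ z : K.cycles i, (K.iCycles i).hom z = x := by
  subst hj
  refine ⟨(K.sc i).moduleCatCyclesIso.inv.hom ⟨x, hx⟩, ?_⟩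
  exact congrArg (fun f => f.hom ⟨x, hx⟩) (K.sc i).moduleCatCyclesIso_inv_iCycles

lemma HomologicalComplex.exists_d_eq (K : HomologicalComplex (ModuleCat.{v} k) c)
    {i j : ι} (hi : c.prev j = i) (z : K.cycles j) (hz : (K.homologyπ j).hom z = 0) :
    ∃ y : K.X i, (K.d i j).hom y = (K.iCycles j).hom z := by
  have h := (ShortComplex.moduleCat_exact_iff _).1
    (ShortComplex.exact_of_g_is_cokernel
      (ShortComplex.mk (K.toCycles i j) (K.homologyπ j) (K.toCycles_comp_homologyπ i j))
      (K.homologyIsCokernel i j hi)) z hz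
  obtain ⟨y, rfl⟩ := h
  exact ⟨y, congrArg (fun f => f.hom y) (K.toCycles_i i j).symm⟩

end

/-! ### Realizing every page as a direct summand of the first one. -/

namespace CategoryTheory.SpectralSequence

variable {k : Type u} [Field k] {κ : Type*} {c : ℤ → ComplexShape κ} {r₀ : ℤ}
  (E : SpectralSequence (ModuleCat.{v} k) c r₀)

/-- A projection of a page onto the next one, extending the projection from cycles. -/
noncomputable def nextProj (r r' : ℤ) (a : κ) (h : r + 1 = r') (hr : r₀ ≤ r) :
    (E.page r).X a ⟶ (E.page r').X a :=
  ((E.page r).exists_retraction_iCycles a).choose ≫ (E.page r).homologyπ a ≫ (E.iso r r' a).hom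

/-- A section of the projection of a page onto the next one, with values in the cycles. -/
noncomputable def nextIncl (r r' : ℤ) (a : κ) (h : r + 1 = r') (hr : r₀ ≤ r) :
    (E.page r').X a ⟶ (E.page r).X a :=
  (E.iso r r' a).inv ≫ ((E.page r).exists_section_homologyπ a).choose ≫ (E.page r).iCycles a

variable {r r' : ℤ} (h : r + 1 = r') (hr : r₀ ≤ r) (a : κ)

lemma iCycles_nextProj : (E.page r).iCycles a ≫ E.nextProj r r' a h hr =
    (E.page r).homologyπ a ≫ (E.iso r r' a).hom := by
  rw [nextProj, ← Category.assoc, ((E.page r).exists_retraction_iCycles a).choose_spec,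
    Category.id_comp]

lemma nextIncl_nextProj : E.nextIncl r r' a h hr ≫ E.nextProj r r' a h hr = 𝟙 _ := by
  rw [nextIncl, Category.assoc, Category.assoc, iCycles_nextProj, ← Category.assoc (Exists.choose _),
    ((E.page r).exists_section_homologyπ a).choose_spec, Category.id_comp, Iso.inv_hom_id]

lemma nextIncl_d (b : κ) : E.nextIncl r r' a h hr ≫ (E.page r).d a b = 0 := by
  rw [nextIncl, Category.assoc, Category.assoc, HomologicalComplex.iCycles_d,
    Limits.comp_zero, Limits.comp_zero]

lemma d_nextProj (b : κ) : (E.page r).d b a ≫ E.nextProj r r' a h hr = 0 := by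
  rw [← HomologicalComplex.toCycles_i, Category.assoc, iCycles_nextProj, ← Category.assoc,
    HomologicalComplex.toCycles_comp_homologyπ, Limits.zero_comp]

/-- This supplies the field `exact` of `SplitPages`, stated on the page itself. -/
lemma exists_d_eq_of_nextProj_eq_zero {b b' : κ} (hb : (c r).prev a = b) (hb' : (c r).next a = b')
    (x : (E.page r).X a) (hx : (E.nextProj r r' a h hr).hom x = 0)
    (hx' : ((E.page r).d a b').hom x = 0) :
    ∃ y : (E.page r).X b, (E.nextProj r r' b h hr).hom y = 0 ∧ ((E.page r).d b a).hom y = x := by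
  obtain ⟨z, rfl⟩ := (E.page r).exists_iCycles_eq hb' x hx'
  have hz : ((E.page r).homologyπ a).hom z = 0 := by
    have h₁ : (E.iso r r' a).hom.hom (((E.page r).homologyπ a).hom z) = 0 :=
      (congrArg (fun f => f.hom z) (E.iCycles_nextProj h hr a)).symm.trans hx
    exact (E.iso r r' a).toLinearEquiv.injective (h₁.trans (map_zero _).symm)
  obtain ⟨y, hy⟩ := (E.page r).exists_d_eq hb z hz
  -- Subtracting the summand of `y` on the next page makes its projection there vanish. The boundary
  -- is unchanged because that summand consists of cycles.
  refine ⟨y - (E.nextIncl r r' b h hr).hom ((E.nextProj r r' b h hr).hom y), ?_, ?_⟩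
  · have h₁ := congrArg (fun f => f.hom ((E.nextProj r r' b h hr).hom y))
      (E.nextIncl_nextProj h hr b)
    rw [map_sub, sub_eq_zero]
    exact h₁.symm
  · have h₁ := congrArg (fun f => f.hom ((E.nextProj r r' b h hr).hom y))
      (E.nextIncl_d h hr b a)
    rw [map_sub, hy, sub_eq_self]
    exact h₁

/-- Auxiliary definition for `pageProj`. -/
noncomputable def pageProjAux : (m : ℕ) → (r : ℤ) → r₀ + m = r → (hr : r₀ ≤ r) → (a : κ) →
    ((E.page r₀).X a ⟶ (E.page r hr).X a)
  -- The index `r` is kept free and tied to `m` by an equation, so only the base case needs a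
  -- transport between equal pages.
  | 0, r, h, hr, a => (E.pageXIsoOfEq a r₀ r (by lia)).hom
  | m + 1, r, h, hr, a =>
    pageProjAux m (r - 1) (by lia) (by lia) a ≫ E.nextProj (r - 1) r a (by lia) (by lia)

/-- Auxiliary definition for `pageIncl`. -/
noncomputable def pageInclAux : (m : ℕ) → (r : ℤ) → r₀ + m = r → (hr : r₀ ≤ r) → (a : κ) →
    ((E.page r hr).X a ⟶ (E.page r₀).X a)
  | 0, r, h, hr, a => (E.pageXIsoOfEq a r₀ r (by lia)).inv
  | m + 1, r, h, hr, a =>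
    E.nextIncl (r - 1) r a (by lia) (by lia) ≫ pageInclAux m (r - 1) (by lia) (by lia) a

/-- The projection from the first page onto the `r`-th one. -/
noncomputable def pageProj (r : ℤ) (hr : r₀ ≤ r) (a : κ) :
    (E.page r₀).X a ⟶ (E.page r).X a :=
  E.pageProjAux (r - r₀).toNat r (by lia) hr a

/-- The inclusion of the `r`-th page into the first one. -/
noncomputable def pageIncl (r : ℤ) (hr : r₀ ≤ r) (a : κ) :
    (E.page r).X a ⟶ (E.page r₀).X a :=
  E.pageInclAux (r - r₀).toNat r (by lia) hr a

lemma pageProj_eq (m : ℕ) (r : ℤ) (hm : r₀ + m = r) (hr : r₀ ≤ r) (a : κ) :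
    E.pageProj r hr a = E.pageProjAux m r hm hr a := by
  obtain rfl : m = (r - r₀).toNat := by lia
  rfl

lemma pageIncl_eq (m : ℕ) (r : ℤ) (hm : r₀ + m = r) (hr : r₀ ≤ r) (a : κ) :
    E.pageIncl r hr a = E.pageInclAux m r hm hr a := by
  obtain rfl : m = (r - r₀).toNat := by lia
  rfl

lemma pageProj_self : E.pageProj r₀ le_rfl a = 𝟙 _ := by
  rw [E.pageProj_eq 0 r₀ (by simp)]; rfl

lemma pageIncl_self : E.pageIncl r₀ le_rfl a = 𝟙 _ := by
  rw [E.pageIncl_eq 0 r₀ (by simp)]; rfl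

lemma pageProj_succ : E.pageProj r' (by lia) a =
    E.pageProj r hr a ≫ E.nextProj r r' a h hr := by
  obtain rfl : r = r' - 1 := by lia
  rw [E.pageProj_eq ((r' - 1 - r₀).toNat + 1) r' (by lia)]
  rfl

lemma pageIncl_succ : E.pageIncl r' (by lia) a =
    E.nextIncl r r' a h hr ≫ E.pageIncl r hr a := by
  obtain rfl : r = r' - 1 := by lia
  rw [E.pageIncl_eq ((r' - 1 - r₀).toNat + 1) r' (by lia)]
  rfl

lemma pageIncl_pageProj : E.pageIncl r hr a ≫ E.pageProj r hr a = 𝟙 _ := by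
  induction r, hr using Int.leInduction with
  | base => rw [pageIncl_self, pageProj_self, Category.comp_id]
  | succ r hr ih =>
    rw [E.pageIncl_succ rfl hr, E.pageProj_succ rfl hr, Category.assoc, ← Category.assoc _ _
      (E.nextProj _ _ _ _ _), ih, Category.id_comp, nextIncl_nextProj]

/-- The projector of the first page whose image is the `r`-th page. -/
noncomputable def pageEnd (r : ℤ) (hr : r₀ ≤ r) (a : κ) : (E.page r₀).X a ⟶ (E.page r₀).X a :=
  E.pageProj r hr a ≫ E.pageIncl r hr a

lemma pageEnd_pageProj {s t : ℤ} (hs : r₀ ≤ s) (hst : s ≤ t) :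
    E.pageEnd s hs a ≫ E.pageProj t (by lia) a = E.pageProj t (by lia) a := by
  induction t, hst using Int.leInduction with
  | base => rw [pageEnd, Category.assoc, pageIncl_pageProj, Category.comp_id]
  | succ t hst ih => rw [E.pageProj_succ rfl (by lia), ← Category.assoc, ih]

lemma pageIncl_pageEnd {s t : ℤ} (hs : r₀ ≤ s) (hst : s ≤ t) :
    E.pageIncl t (by lia) a ≫ E.pageEnd s hs a = E.pageIncl t (by lia) a := by
  induction t, hst using Int.leInduction with
  | base => rw [pageEnd, ← Category.assoc, pageIncl_pageProj, Category.id_comp]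
  | succ t hst ih => rw [E.pageIncl_succ rfl (by lia), Category.assoc, ih]

lemma pageIncl_pageProj_succ : E.pageIncl r hr a ≫ E.pageProj r' (by lia) a =
    E.nextProj r r' a h hr := by
  rw [E.pageProj_succ h hr, ← Category.assoc, pageIncl_pageProj, Category.id_comp]

lemma pageIncl_succ_pageProj : E.pageIncl r' (by lia) a ≫ E.pageProj r hr a =
    E.nextIncl r r' a h hr := by
  rw [E.pageIncl_succ h hr, Category.assoc, pageIncl_pageProj, Category.comp_id]

/-- The projection to page `s` factors through page `t + 1`, where boundaries of `d_t` are already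
zero. -/
lemma d_pageIncl_pageProj {t s : ℤ} (ht : r₀ ≤ t) (hs : t < s) (b : κ) :
    (E.page t).d b a ≫ E.pageIncl t ht a ≫ E.pageProj s (by lia) a = 0 := by
  rw [← E.pageEnd_pageProj a (s := t + 1) (by lia) (by lia), pageEnd]
  simp only [← Category.assoc]
  rw [Category.assoc _ (E.pageIncl t ht a), E.pageIncl_pageProj_succ rfl ht, d_nextProj]
  simp only [Limits.zero_comp]

/-- Dually, the inclusion of page `s` factors through page `t + 1`, which sits inside the cycles of
`d_t`. -/
lemma pageIncl_pageProj_d {t s : ℤ} (ht : r₀ ≤ t) (hs : t < s) (b : κ) :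
    E.pageIncl s (by lia) a ≫ E.pageProj t ht a ≫ (E.page t).d a b = 0 := by
  rw [← E.pageIncl_pageEnd a (s := t + 1) (by lia) (by lia), pageEnd]
  simp only [Category.assoc]
  rw [← Category.assoc (E.pageIncl (t + 1) _ a), E.pageIncl_succ_pageProj rfl ht, nextIncl_d]
  simp only [Limits.comp_zero]

end CategoryTheory.SpectralSequence

/-! ### The differentials of all pages transported to the first page. -/

namespace CategoryTheory.SpectralSequence

variable {k : Type u} [Field k] {r₀ : ℤ}
  (E : CohomologicalSpectralSequence (ModuleCat.{v} k) r₀)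

open scoped Classical in
/-- The projector `pageEnd`, extended by zero to all `r : ℤ`. -/
noncomputable def splitP (r : ℤ) (a : ℤ × ℤ) : (E.page r₀).X a ⟶ (E.page r₀).X a :=
  if hr : r₀ ≤ r then E.pageEnd r hr a else 0

open scoped Classical in
/-- The differential of the page `r = b.1 - a.1`, transported to the first page. -/
noncomputable def splitD (a b : ℤ × ℤ) : (E.page r₀).X a ⟶ (E.page r₀).X b :=
  if hr : r₀ ≤ b.1 - a.1 then
    E.pageProj (b.1 - a.1) hr a ≫ (E.page (b.1 - a.1)).d a b ≫ E.pageIncl (b.1 - a.1) hr b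
  else 0

variable {r s : ℤ} {a b : ℤ × ℤ}

lemma splitP_eq (hr : r₀ ≤ r) : E.splitP r a = E.pageEnd r hr a := dif_pos hr

lemma splitD_eq (hr : r₀ ≤ r) (h : b.1 - a.1 = r) :
    E.splitD a b = E.pageProj r hr a ≫ (E.page r).d a b ≫ E.pageIncl r hr b := by
  subst h; exact dif_pos hr

lemma splitD_eq_zero (h : ¬(r₀ ≤ b.1 - a.1 ∧ a.1 + a.2 + 1 = b.1 + b.2)) : E.splitD a b = 0 := by
  by_cases hr : r₀ ≤ b.1 - a.1
  · rw [E.splitD_eq hr rfl, HomologicalComplex.shape, Limits.zero_comp, Limits.comp_zero]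
    exact fun hab => h ⟨hr, (FilteredComplex.rel_deg hab).2⟩
  · exact dif_neg hr

lemma splitP_pageProj (hs : r₀ ≤ s) (hsr : s ≤ r) :
    E.splitP s a ≫ E.pageProj r (by lia) a = E.pageProj r (by lia) a := by
  rw [E.splitP_eq hs, E.pageEnd_pageProj a hs hsr]

lemma pageIncl_splitP (hs : r₀ ≤ s) (hsr : s ≤ r) :
    E.pageIncl r (by lia) a ≫ E.splitP s a = E.pageIncl r (by lia) a := by
  rw [E.splitP_eq hs, E.pageIncl_pageEnd a hs hsr]

lemma splitP_splitP_of_le (hs : r₀ ≤ s) (hsr : s ≤ r) :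
    E.splitP s a ≫ E.splitP r a = E.splitP r a := by
  rw [E.splitP_eq (r := r) (by lia), pageEnd, ← Category.assoc, E.splitP_pageProj hs hsr]

lemma splitP_splitP_of_ge (hs : r₀ ≤ s) (hsr : s ≤ r) :
    E.splitP r a ≫ E.splitP s a = E.splitP r a := by
  rw [E.splitP_eq (r := r) (by lia), pageEnd, Category.assoc, E.pageIncl_splitP hs hsr]

lemma splitD_splitP_self (h : b.1 - a.1 = r) : E.splitD a b ≫ E.splitP r b = E.splitD a b := by
  by_cases hr : r₀ ≤ r
  · rw [E.splitD_eq hr h, Category.assoc, Category.assoc, E.pageIncl_splitP hr le_rfl]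
  · rw [E.splitD_eq_zero (by lia), Limits.zero_comp]

lemma splitP_splitD_self (h : b.1 - a.1 = r) : E.splitP r a ≫ E.splitD a b = E.splitD a b := by
  by_cases hr : r₀ ≤ r
  · rw [E.splitD_eq hr h, ← Category.assoc, E.splitP_pageProj hr le_rfl]
  · rw [E.splitD_eq_zero (by lia), Limits.comp_zero]

lemma splitD_splitP (h : b.1 - a.1 < r) : E.splitD a b ≫ E.splitP r b = 0 := by
  by_cases hr : r₀ ≤ b.1 - a.1
  · have h' := E.d_pageIncl_pageProj b hr h a
    rw [E.splitD_eq hr rfl, E.splitP_eq (by lia), pageEnd]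
    simp only [← Category.assoc] at h' ⊢
    rw [Category.assoc (E.pageProj _ _ _), Category.assoc (E.pageProj _ _ _), h']
    simp only [Limits.comp_zero, Limits.zero_comp]
  · rw [E.splitD_eq_zero (by lia), Limits.zero_comp]

lemma splitP_splitD (h : b.1 - a.1 < r) : E.splitP r a ≫ E.splitD a b = 0 := by
  by_cases hr : r₀ ≤ b.1 - a.1
  · have h' := E.pageIncl_pageProj_d a hr h b
    rw [E.splitD_eq hr rfl, E.splitP_eq (by lia), pageEnd, Category.assoc,
      reassoc_of% h', Limits.zero_comp, Limits.comp_zero]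
  · rw [E.splitD_eq_zero (by lia), Limits.comp_zero]

/-- If the second differential is longer, it factors through a page where the image of the first has
died. If the lengths agree, this is `d_r ∘ d_r = 0`. If the second is shorter, the image of the
first lies on a later page, hence among its cycles. -/
lemma splitD_splitD (a b c : ℤ × ℤ) : E.splitD a b ≫ E.splitD b c = 0 := by
  rcases lt_trichotomy (b.1 - a.1) (c.1 - b.1) with h | h | h
  · rw [← E.splitP_splitD_self (a := b) rfl, ← Category.assoc, E.splitD_splitP h,
      Limits.zero_comp]
  · by_cases hr : r₀ ≤ c.1 - b.1
    · rw [E.splitD_eq hr h, E.splitD_eq hr rfl]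
      simp only [Category.assoc]
      rw [← Category.assoc (E.pageIncl _ _ _), pageIncl_pageProj, Category.id_comp,
        HomologicalComplex.d_comp_d_assoc, Limits.zero_comp, Limits.comp_zero]
    · rw [E.splitD_eq_zero (a := b) (by lia), Limits.comp_zero]
  · rw [← E.splitD_splitP_self (a := a) rfl, Category.assoc, E.splitP_splitD h,
      Limits.comp_zero]

lemma pageProj_pageIncl_apply (hr : r₀ ≤ r) (x : (E.page r).X a) :
    (E.pageProj r hr a).hom ((E.pageIncl r hr a).hom x) = x :=
  congrArg (fun f => f.hom x) (E.pageIncl_pageProj hr a)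

lemma pageIncl_injective (hr : r₀ ≤ r) (a : ℤ × ℤ) :
    Function.Injective (E.pageIncl r hr a).hom :=
  Function.LeftInverse.injective (E.pageProj_pageIncl_apply hr)

lemma splitP_apply (hr : r₀ ≤ r) (x : (E.page r₀).X a) :
    (E.splitP r a).hom x = (E.pageIncl r hr a).hom ((E.pageProj r hr a).hom x) := by
  rw [E.splitP_eq hr]; rfl

lemma splitP_apply_eq_zero_iff (hr : r₀ ≤ r) (x : (E.page r₀).X a) :
    (E.splitP r a).hom x = 0 ↔ (E.pageProj r hr a).hom x = 0 := by
  rw [E.splitP_apply hr]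
  exact map_eq_zero_iff _ (E.pageIncl_injective hr a)

lemma splitD_apply (hr : r₀ ≤ r) (h : b.1 - a.1 = r) (x : (E.page r₀).X a) :
    (E.splitD a b).hom x = (E.pageIncl r hr b).hom
      (((E.page r).d a b).hom ((E.pageProj r hr a).hom x)) := by
  rw [E.splitD_eq hr h]; rfl

lemma nextProj_pageProj_apply (hr : r₀ ≤ r) (x : (E.page r₀).X a) :
    (E.nextProj r (r + 1) a rfl hr).hom ((E.pageProj r hr a).hom x) =
      (E.pageProj (r + 1) (by lia) a).hom x :=
  congrArg (fun f => f.hom x) (E.pageProj_succ rfl hr a).symm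

lemma exists_splitD_eq (hr : r₀ ≤ r) (a : ℤ × ℤ) (x : (E.page r₀).X a)
    (hx : (E.splitP r a).hom x = x) (hx' : (E.splitP (r + 1) a).hom x = 0)
    (hd : ∀ c : ℤ × ℤ, c.1 - a.1 = r → (E.splitD a c).hom x = 0) :
    ∃ (a' : ℤ × ℤ) (y : (E.page r₀).X a'), a.1 - a'.1 = r ∧ a'.1 + a'.2 + 1 = a.1 + a.2 ∧
      (E.splitP r a').hom y = y ∧ (E.splitP (r + 1) a').hom y = 0 ∧
        (E.splitD a' a).hom y = x := by
  have hprev := FilteredComplex.rel_prev r a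
  have hnext := FilteredComplex.rel_next r a
  have hdeg := FilteredComplex.rel_deg hprev
  have hdeg' := FilteredComplex.rel_deg hnext
  have h₁ := hd _ (show (a + ⟨r, 1 - r⟩ : ℤ × ℤ).1 - a.1 = r by lia)
  rw [E.splitD_apply hr (by lia)] at h₁
  rw [E.splitP_apply_eq_zero_iff (by lia), ← E.nextProj_pageProj_apply hr] at hx'
  obtain ⟨y, hy, hdy⟩ := E.exists_d_eq_of_nextProj_eq_zero rfl hr a
    ((ComplexShape.up' (⟨r, 1 - r⟩ : ℤ × ℤ)).prev_eq' hprev)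
    ((ComplexShape.up' (⟨r, 1 - r⟩ : ℤ × ℤ)).next_eq' hnext) _ hx'
    ((map_eq_zero_iff _ (E.pageIncl_injective hr _)).1 h₁)
  refine ⟨a - ⟨r, 1 - r⟩, (E.pageIncl r hr _).hom y, by lia, hdeg.2, ?_, ?_, ?_⟩
  · rw [E.splitP_apply hr, E.pageProj_pageIncl_apply hr]
  · rw [E.splitP_apply_eq_zero_iff (by lia), ← E.nextProj_pageProj_apply hr,
      E.pageProj_pageIncl_apply hr, hy]
  · rw [E.splitD_apply hr (by lia), E.pageProj_pageIncl_apply hr, hdy, ← E.splitP_apply hr, hx]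

/-- Compatibility with the passage to homology can be checked on `Z_{r+1}^p`. -/
lemma homologyMap_comp_iso {A : FilteredComplex.{u, v} k} (hr : r₀ ≤ r)
    (f : A.page r ⟶ E.page r) (a : ℤ × ℤ) (g : (A.page (r + 1)).X a ⟶ (E.page (r + 1)).X a)
    (h : ∀ x : A.Z (r + 1) a.1 (a.1 + a.2),
      (E.nextProj r (r + 1) a rfl hr).hom ((f.f a).hom (A.toE r a x)) =
        g.hom (FilteredComplex.E.mk (r + 1) _ _ x)) :
    HomologicalComplex.homologyMap f a ≫ (E.iso r (r + 1) a).hom = (A.pageIso r a).hom ≫ g := by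
  refine ModuleCat.hom_ext (LinearMap.ext fun z => ?_)
  obtain ⟨x, hx⟩ := FilteredComplex.E.mk_surjective _ _ _ ((A.pageIso r a).hom.hom z)
  obtain ⟨c, hc⟩ := (A.page r).exists_iCycles_eq
    (ComplexShape.next_eq' _ (FilteredComplex.rel_next r a)) (A.toE r a x) (A.toKer r a x).2
  -- Every homology class `z` is represented by `[x]` with `x` in `Z_{r+1}`: both have the same
  -- image under the injective `pageIso`.
  obtain rfl : ((A.page r).homologyπ a).hom c = z :=
    (A.pageIso r a).toLinearEquiv.injective ((A.pageIso_hom_apply r a x c hc).trans hx)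
  -- On cycles, `nextProj` is the passage to homology followed by the structure isomorphism of `E`,
  -- so homology can be replaced by an identity between maps on the page.
  have h₁ : (A.page r).homologyπ a ≫ HomologicalComplex.homologyMap f a ≫
      (E.iso r (r + 1) a).hom =
      (A.page r).iCycles a ≫ f.f a ≫ E.nextProj r (r + 1) a rfl hr := by
    rw [HomologicalComplex.homologyπ_naturality_assoc, ← E.iCycles_nextProj rfl hr,
      HomologicalComplex.cyclesMap_i_assoc]
  calc _ = (E.nextProj r (r + 1) a rfl hr).hom ((f.f a).hom (((A.page r).iCycles a).hom c)) :=
        congrArg (fun f => f.hom c) h₁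
    _ = g.hom ((A.pageIso r a).hom.hom (((A.page r).homologyπ a).hom c)) := by
        rw [hc, ← hx]; exact h x
    _ = _ := rfl

/-- All pages of a spectral sequence over a field, realized inside the first one. -/
noncomputable def splitPages : SplitPages.{u, v} k r₀ where
  V a := (E.page r₀).X a
  P r a := (E.splitP r a).hom
  D a b := (E.splitD a b).hom
  D_eq_zero h := by rw [E.splitD_eq_zero h]; rfl
  P_init a x := by rw [E.splitP_eq le_rfl, pageEnd, pageProj_self, pageIncl_self]; rfl
  P_P_of_le h h₀ _ x := congrArg (fun f => f.hom x) (E.splitP_splitP_of_le h₀ h)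
  P_P_of_ge h h₀ _ x := congrArg (fun f => f.hom x) (E.splitP_splitP_of_ge h₀ h)
  P_D_self h x := congrArg (fun f => f.hom x) (E.splitD_splitP_self h)
  D_P_self h x := congrArg (fun f => f.hom x) (E.splitP_splitD_self h)
  P_D h x := congrArg (fun f => f.hom x) (E.splitD_splitP h)
  D_P h x := congrArg (fun f => f.hom x) (E.splitP_splitD h)
  D_D a b c x := congrArg (fun f => f.hom x) (E.splitD_splitD a b c)
  exact h₀ a x hx hx' hd := E.exists_splitD_eq h₀ a x hx hx' hd

/-! ### Comparison of the spectral sequence of the filtered complex with `E`. -/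

/-- A filtered complex whose spectral sequence is isomorphic to `E`. -/
noncomputable abbrev filteredComplex (hr₀ : 0 ≤ r₀) : FilteredComplex.{u, v} k :=
  E.splitPages.filteredComplex hr₀

section

variable (hr₀ : 0 ≤ r₀) (r : ℤ) (hr : r₀ ≤ r) (a : ℤ × ℤ)

/-- The projection to the `r`-th page of the leading term of an element of `Z_r^p`. -/
noncomputable def leadingTerm :
    (E.filteredComplex hr₀).Z r a.1 (a.1 + a.2) →ₗ[k] (E.page r).X a :=
  (E.pageProj r hr a).hom ∘ₗ (show E.splitPages.T (a.1 + a.2) →ₗ[k] (E.page r₀).X a from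
    LinearMap.proj (φ := fun a => E.splitPages.V a) a ∘ₗ
      (E.splitPages.T (a.1 + a.2)).subtype) ∘ₗ
    ((E.filteredComplex hr₀).Z r a.1 (a.1 + a.2)).subtype

lemma leadingTerm_surjective : Function.Surjective (E.leadingTerm hr₀ r hr a) := by
  intro y
  refine ⟨⟨SplitPages.single a rfl ((E.pageIncl r hr a).hom y), SplitPages.single_mem_Z hr₀ a ?_⟩,
    ?_⟩
  · exact (E.splitP_apply hr _).trans (congrArg _ (E.pageProj_pageIncl_apply hr y))
  · exact (congrArg (E.pageProj r hr a).hom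
      (SplitPages.single_same (S := E.splitPages) a rfl _)).trans (E.pageProj_pageIncl_apply hr y)

lemma ker_leadingTerm : LinearMap.ker (E.leadingTerm hr₀ r hr a) =
    ((E.filteredComplex hr₀).B r a.1 (a.1 + a.2)).submoduleOf
      ((E.filteredComplex hr₀).Z r a.1 (a.1 + a.2)) := by
  ext x
  exact ((SplitPages.mem_B_iff hr₀ hr a x.2).trans (E.splitP_apply_eq_zero_iff hr _)).symm

/-- The identification of the pages of the filtered complex with those of `E`. -/
noncomputable def pageXEquiv :
    (E.filteredComplex hr₀).E r a.1 (a.1 + a.2) ≃ₗ[k] (E.page r).X a :=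
  Submodule.quotEquivOfEq _ _ (E.ker_leadingTerm hr₀ r hr a).symm ≪≫ₗ
    (E.leadingTerm hr₀ r hr a).quotKerEquivOfSurjective (E.leadingTerm_surjective hr₀ r hr a)

/-- Equality can be tested after the injection into the first page, where it becomes `P_d_apply`. -/
lemma leadingTerm_dZ {a b : ℤ × ℤ} (hab : a.1 + r = b.1) (hdeg : a.1 + a.2 + 1 = b.1 + b.2)
    (x : (E.filteredComplex hr₀).Z r a.1 (a.1 + a.2)) :
    E.leadingTerm hr₀ r hr b (FilteredComplex.dZ hab hdeg x) =
      ((E.page r).d a b).hom (E.leadingTerm hr₀ r hr a x) := by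
  have h := SplitPages.P_d_apply hr₀ hab hdeg x.2
  refine E.pageIncl_injective hr b
    (Eq.trans ?_ (h.trans (E.splitD_apply hr (a := a) (b := b) (by lia) _)))
  refine Eq.trans ?_ (E.splitP_apply hr _).symm
  rw [← SplitPages.filteredComplex_d E.splitPages hr₀ hdeg]
  rfl

/-- The isomorphism between the pages of the filtered complex and those of `E`. -/
noncomputable def filteredPageIso : (E.filteredComplex hr₀).page r ≅ E.page r :=
  HomologicalComplex.Hom.isoOfComponents (fun a => (E.pageXEquiv hr₀ r hr a).toModuleIso) (by
    intro a b hab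
    rw [FilteredComplex.page_d _ hab]
    refine ModuleCat.hom_ext (LinearMap.ext fun x => ?_)
    obtain ⟨x, rfl⟩ := FilteredComplex.E.mk_surjective _ _ _ x
    exact (E.leadingTerm_dZ hr₀ r hr (FilteredComplex.rel_deg hab).1
      (FilteredComplex.rel_deg hab).2 x).symm)

/-- For `x` in `Z_{r+1}` both sides start from the same leading term, and projecting it to page `r`
and then to page `r + 1` is projecting it to page `r + 1`. -/
lemma homologyMap_filteredPageIso :
    HomologicalComplex.homologyMap (E.filteredPageIso hr₀ r hr).hom a ≫
        (E.iso r (r + 1) a).hom =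
      ((E.filteredComplex hr₀).pageIso r a).hom ≫
        (E.filteredPageIso hr₀ (r + 1) (by lia)).hom.f a :=
  E.homologyMap_comp_iso hr _ a _ fun _ => E.nextProj_pageProj_apply hr _

end

/-- A family of isomorphisms of pages compatible with the passage to homology is an isomorphism of
spectral sequences. -/
def isoOfPages {C κ : Type*} [Category* C] [Abelian C] {c : ℤ → ComplexShape κ} {r₀ : ℤ}
    {E E' : SpectralSequence C c r₀} (f : ∀ (r : ℤ) (hr : r₀ ≤ r), E.page r hr ≅ E'.page r hr)
    (hf : ∀ (r r' : ℤ) (a : κ) (h : r + 1 = r') (hr : r₀ ≤ r),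
      HomologicalComplex.homologyMap (f r hr).hom a ≫ (E'.iso r r' a).hom =
        (E.iso r r' a).hom ≫ (f r' (by lia)).hom.f a) : E ≅ E' where
  hom := { hom r hr := (f r hr).hom, comm r r' a h hr := hf r r' a h hr }
  inv :=
    { hom r hr := (f r hr).inv
      comm r r' a h hr := by
        rw [← cancel_epi (HomologicalComplex.homologyMap (f r hr).hom a),
          ← HomologicalComplex.homologyMap_comp_assoc, Iso.hom_inv_id,
          HomologicalComplex.homologyMap_id, Category.id_comp, ← Category.assoc, hf r r' a h hr,
          Category.assoc, ← HomologicalComplex.comp_f, Iso.hom_inv_id, HomologicalComplex.id_f,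
          Category.comp_id] }
  hom_inv_id := by ext1 r hr; exact (f r hr).hom_inv_id
  inv_hom_id := by ext1 r hr; exact (f r hr).inv_hom_id

/-- The spectral sequence of the filtered complex attached to `E` is isomorphic to `E`. -/
noncomputable def filteredComplexIso (hr₀ : 0 ≤ r₀) :
    (E.filteredComplex hr₀).spectralSequence r₀ ≅ E :=
  isoOfPages (fun r hr => E.filteredPageIso hr₀ r hr) (by
    rintro r _ a rfl hr
    refine (E.homologyMap_filteredPageIso hr₀ r hr a).trans ?_
    congr 1)

end CategoryTheory.SpectralSequence

theorem mainTheorem5 {k : Type u} [Field k] (r₀ : ℤ) (hr₀ : 1 ≤ r₀)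
    (E : CohomologicalSpectralSequence (ModuleCat.{v} k) r₀) :
    ∃ A : FilteredComplex.{u, v} k, A.IsExhaustive ∧ A.IsGradedComplete ∧
      Nonempty (A.spectralSequence r₀ ≅ E) := by
  have h : 0 ≤ r₀ := by lia
  exact ⟨E.filteredComplex h, E.splitPages.isExhaustive h, E.splitPages.isGradedComplete h,
    ⟨E.filteredComplexIso h⟩⟩
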